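/- For a function $f:X\to X$ on a nonempty finite set $X$, its degree of noninvertibility is $$\deg(f)=\frac{1}{|X|}\sum_{x\in X}|f^{-1}(f(x))|.$$ Let $S_n$ be the set of permutations of $\{1,\dots,n\}$, viewed as words $\pi=\pi_1\cdots\pi_n$. West's stack-sorting map $s$ is defined recursively on words with distinct positive integer entries: $s$ sends the empty word to itself, and if $\pi$ is nonempty with largest entry $m$, written $\pi=LmR$, then $s(\pi)=s(L)\,s(R)\,m$. It restricts to a map $s:S_n\to S_n$ for every $n\geq 1$. Theorem. The limit $\lim_{n\to\infty}\deg(s:S_n\to S_n)^{1/n}$ exists and satisfies $$1.12462\leq\lim_{n\to\infty}\deg(s:S_n\to S_n)^{1/n}\leq 4.$$ -/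

import Mathlib

open Filter Topology

namespace StackSorting

/-- The degree of noninjectivity (of noninvertibility, when `X = Y`) of a map of finite sets:
`deg f = (1 / |X|) * ∑ x, |f⁻¹(f x)|`. -/
noncomputable def degree {X Y : Type*} [Fintype X] (f : X → Y) : ℝ :=
  (1 / (Fintype.card X : ℝ)) * ∑ x : X, ((f ⁻¹' {f x}).ncard : ℝ)

/-- The largest entry of a word of natural numbers (`0` for the empty word). -/
def largest : List ℕ → ℕ
  | [] => 0
  | a :: t => max a (largest t)

theorem largest_mem : ∀ {l : List ℕ}, l ≠ [] → largest l ∈ l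
  | [], h => absurd rfl h
  | [a], _ => by simp [largest]
  | a :: b :: t, _ => by
    have ih := largest_mem (l := b :: t) (by simp)
    rw [largest]
    rcases max_choice a (largest (b :: t)) with h | h
    · rw [h]; exact List.mem_cons_self
    · rw [h]; exact List.mem_cons_of_mem _ ih

/-- The part of a word to the left of its (first) largest entry. -/
def left (l : List ℕ) : List ℕ := l.take (l.idxOf (largest l))

/-- The part of a word to the right of its (first) largest entry. -/
def right (l : List ℕ) : List ℕ := l.drop (l.idxOf (largest l) + 1)

theorem left_append_largest_right {l : List ℕ} (h : l ≠ []) :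
    left l ++ largest l :: right l = l := by
  have hi : l.idxOf (largest l) < l.length := List.idxOf_lt_length_of_mem (largest_mem h)
  have hg : l[l.idxOf (largest l)] = largest l := List.getElem_idxOf hi
  have hd := List.drop_eq_getElem_cons hi
  rw [hg] at hd
  rw [left, right, ← hd, List.take_append_drop]

theorem length_left_lt {l : List ℕ} (h : l ≠ []) : (left l).length < l.length := by
  have := congrArg List.length (left_append_largest_right h)
  simp only [List.length_append, List.length_cons] at this
  omega

theorem length_right_lt {l : List ℕ} (h : l ≠ []) : (right l).length < l.length := by
  have := congrArg List.length (left_append_largest_right h)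
  simp only [List.length_append, List.length_cons] at this
  omega

/-- West's stack-sorting map on words: the empty word is fixed, and
`s (L m R) = s(L) s(R) m`, where `m` is the largest entry of the word `L m R`. -/
def stackSort (l : List ℕ) : List ℕ :=
  if l = [] then []
  else stackSort (left l) ++ stackSort (right l) ++ [largest l]
termination_by l.length
decreasing_by
  · exact length_left_lt ‹_›
  · exact length_right_lt ‹_›

theorem stackSort_perm (l : List ℕ) : (stackSort l).Perm l := by
  induction hn : l.length using Nat.strong_induction_on generalizing l with
  | _ n ih =>
    subst hn
    rw [stackSort]
    split_ifs with h
    · rw [h]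
    · have hL := ih _ (length_left_lt h) (left l) rfl
      have hR := ih _ (length_right_lt h) (right l) rfl
      calc stackSort (left l) ++ stackSort (right l) ++ [largest l]
          _ = stackSort (left l) ++ (stackSort (right l) ++ [largest l]) :=
            List.append_assoc _ _ _
          List.Perm _ (left l ++ (largest l :: right l)) :=
            hL.append ((List.perm_append_singleton _ _).trans (hR.cons _))
          _ = l := left_append_largest_right h

/-- `S n`: the permutations of `{1, …, n}`, viewed as words. -/
abbrev S (n : ℕ) : Type := {l : List ℕ // l.Perm (List.range' 1 n)}

instance instFintypeS (n : ℕ) : Fintype (S n) :=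
  Fintype.subtype (List.range' 1 n).permutations.toFinset (by simp)

/-- The stack-sorting map `s : S n → S n`. -/
def stackSortMap (n : ℕ) (w : S n) : S n :=
  ⟨stackSort w.1, (stackSort_perm w.1).trans w.2⟩

end StackSorting

namespace StackSorting

/-! Write d_n for the degree on S_n; then n! d_n counts the ordered pairs of permutations with equal
image ("collisions"). A collision on a set B of letters and one on its complement, joined around a
new largest letter, form a collision. Summing over B gives (n+1) d_{n+1} ≥ ∑ d_k d_{n-k}
(`sum_degree_mul_degree_le`), the source of both the limit and the lower bound.

One term of the sum makes log d_{n-1} superadditive up to a logarithmic error, so a Fekete argument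
gives the limit once d_n grows at most exponentially. It does: a word is determined by its image and
the shape of its decreasing binary tree, so fibres have at most Catalan(n) ≤ 4^n elements. This is
also the upper bound. For the lower bound, the whole recurrence, started from d_0, d_1 ≥ 1 and d_2 ≥
2, forces d_n ≥ 1.12462^(n+1) for n ≥ 2. -/

theorem le_largest {l : List ℕ} {x : ℕ} (hx : x ∈ l) : x ≤ largest l := by
  induction l with
  | nil => simp at hx
  | cons a t ih =>
    rw [largest]
    rcases List.mem_cons.1 hx with rfl | h
    · exact le_max_left _ _
    · exact (ih h).trans (le_max_right _ _)

theorem largest_append_cons {L R : List ℕ} {M : ℕ} (hL : ∀ x ∈ L, x < M) (hR : ∀ x ∈ R, x ≤ M) :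
    largest (L ++ M :: R) = M := by
  refine le_antisymm ?_ (le_largest (by simp))
  have h : largest (L ++ M :: R) ∈ L ++ M :: R := largest_mem (by simp)
  rcases List.mem_append.1 h with h | h
  · exact (hL _ h).le
  · rcases List.mem_cons.1 h with h | h
    · exact h.le
    · exact hR _ h

theorem stackSort_nil : stackSort [] = [] := by
  rw [stackSort]; simp

theorem stackSort_append_cons {L R : List ℕ} {M : ℕ} (hL : ∀ x ∈ L, x < M)
    (hR : ∀ x ∈ R, x ≤ M) :
    stackSort (L ++ M :: R) = stackSort L ++ stackSort R ++ [M] := by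
  have hM := largest_append_cons hL hR
  have hML : M ∉ L := fun h => (hL M h).false
  have hi : (L ++ M :: R).idxOf M = L.length := by
    rw [List.idxOf_append, if_neg hML]; simp
  rw [stackSort, if_neg (by simp), left, right, hM, hi]
  simp

/-- A nonempty word without repetitions splits at its largest entry. -/
theorem exists_eq_append_cons {l : List ℕ} (hl : l.Nodup) (h : l ≠ []) :
    ∃ L M R, l = L ++ M :: R ∧ (∀ x ∈ L, x < M) ∧ ∀ x ∈ R, x < M := by
  have e := left_append_largest_right h
  refine ⟨_, _, _, e.symm, fun x hx => ?_, fun x hx => ?_⟩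
  · refine lt_of_le_of_ne (le_largest ?_) ?_
    · rw [← e]; simp [hx]
    · rintro rfl
      rw [← e] at hl
      exact (List.nodup_append.1 hl).2.2 _ hx _ (by simp) rfl
  · refine lt_of_le_of_ne (le_largest ?_) ?_
    · rw [← e]; simp [hx]
    · rintro rfl
      rw [← e] at hl
      exact (List.nodup_cons.1 (List.nodup_append.1 hl).2.1).1 hx

/-! ### Collisions and their recurrence -/

theorem stackSort_map {f : ℕ → ℕ} : ∀ {l : List ℕ}, l.Nodup → StrictMonoOn f {x | x ∈ l} →
    stackSort (l.map f) = (stackSort l).map f := by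
  intro l
  induction hn : l.length using Nat.strong_induction_on generalizing l with
  | _ n ih =>
    subst hn
    intro hl hf
    rcases eq_or_ne l [] with rfl | h
    · simp [stackSort_nil]
    obtain ⟨L, M, R, rfl, hL, hR⟩ := exists_eq_append_cons hl h
    have hnd := List.nodup_append.1 hl
    have iL := ih L.length (by simp) rfl hnd.1 (hf.mono fun x hx => by
      simp only [Set.mem_ofPred_eq] at hx ⊢; simp [hx])
    have iR := ih R.length (by simp; omega) rfl (List.nodup_cons.1 hnd.2.1).2
      (hf.mono fun x hx => by simp only [Set.mem_ofPred_eq] at hx ⊢; simp [hx])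
    rw [List.map_append, List.map_cons, stackSort_append_cons hL fun x hx => (hR x hx).le,
      stackSort_append_cons, iL, iR]
    · simp
    · simp only [List.mem_map, forall_exists_index, and_imp, forall_apply_eq_imp_iff₂]
      exact fun x hx => hf (by simp [hx]) (by simp) (hL x hx)
    · simp only [List.mem_map, forall_exists_index, and_imp, forall_apply_eq_imp_iff₂]
      exact fun x hx => (hf (by simp [hx]) (by simp) (hR x hx)).le

/-- The words using each element of `A` exactly once. -/
def wordsOn (A : Finset ℕ) : Finset (List ℕ) := A.val.lists.toFinset

theorem mem_wordsOn {A : Finset ℕ} {l : List ℕ} : l ∈ wordsOn A ↔ (l : Multiset ℕ) = A.val := by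
  rw [wordsOn, Multiset.mem_toFinset, Multiset.mem_lists_iff]; exact eq_comm

theorem nodup_of_mem_wordsOn {A : Finset ℕ} {l : List ℕ} (h : l ∈ wordsOn A) : l.Nodup := by
  have := A.nodup
  rw [← mem_wordsOn.1 h] at this
  simpa using this

theorem mem_iff_of_mem_wordsOn {A : Finset ℕ} {l : List ℕ} (h : l ∈ wordsOn A) {x : ℕ} :
    x ∈ l ↔ x ∈ A := by
  rw [← Finset.mem_val, ← mem_wordsOn.1 h]; simp

/-- The pairs of words on `A` with the same image under stack-sorting. -/
def collisions (A : Finset ℕ) : Finset (List ℕ × List ℕ) :=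
  (wordsOn A ×ˢ wordsOn A).filter fun p => stackSort p.1 = stackSort p.2

theorem mem_collisions {A : Finset ℕ} {p : List ℕ × List ℕ} : p ∈ collisions A ↔
    (p.1 ∈ wordsOn A ∧ p.2 ∈ wordsOn A) ∧ stackSort p.1 = stackSort p.2 := by
  simp [collisions]

theorem card_collisions_image_le {A : Finset ℕ} {f : ℕ → ℕ} (hf : StrictMonoOn f A) :
    (collisions A).card ≤ (collisions (A.image f)).card := by
  have key : ∀ l ∈ wordsOn A, l.map f ∈ wordsOn (A.image f) := by
    intro l hl
    rw [mem_wordsOn, Finset.image_val_of_injOn hf.injOn, ← mem_wordsOn.1 hl]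
    simp
  have sub : ∀ l ∈ wordsOn A, StrictMonoOn f {x | x ∈ l} := fun l hl =>
    hf.mono fun x hx => (mem_iff_of_mem_wordsOn hl).1 hx
  have inj : ∀ l ∈ wordsOn A, ∀ l' ∈ wordsOn A, l.map f = l'.map f → l = l' := by
    intro l hl l' hl' h
    have inv : ∀ k ∈ wordsOn A, (k.map f).map (Function.invFunOn f A) = k := by
      intro k hk
      rw [List.map_map]
      refine (List.map_congr_left fun x hx => ?_).trans k.map_id
      exact hf.injOn.leftInvOn_invFunOn ((mem_iff_of_mem_wordsOn hk).1 hx)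
    rw [← inv l hl, h, inv l' hl']
  refine Finset.card_le_card_of_injOn (fun p => (p.1.map f, p.2.map f)) ?_ ?_
  · intro p hp
    obtain ⟨⟨h1, h2⟩, h⟩ := mem_collisions.1 hp
    refine mem_collisions.2 ⟨⟨key _ h1, key _ h2⟩, ?_⟩
    simp only
    rw [stackSort_map (nodup_of_mem_wordsOn h1) (sub _ h1),
      stackSort_map (nodup_of_mem_wordsOn h2) (sub _ h2), h]
  · intro p hp q hq h
    obtain ⟨⟨h1, h2⟩, -⟩ := mem_collisions.1 hp
    obtain ⟨⟨h3, h4⟩, -⟩ := mem_collisions.1 hq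
    simp only [Prod.mk.injEq] at h
    exact Prod.ext (inj _ h1 _ h3 h.1) (inj _ h2 _ h4 h.2)

/-- The number of pairs of permutations of `{1, …, n}` with the same image. -/
def numCollisions (n : ℕ) : ℕ := (collisions (Finset.Icc 1 n)).card

/-- Stack-sorting sees only the relative order of the letters, so the increasing enumeration of `A`
carries collisions to collisions. One inequality suffices for the recurrence. -/
theorem numCollisions_le (A : Finset ℕ) : numCollisions A.card ≤ (collisions A).card := by
  -- `Nat.nth` counts from 0, the letters from 1.
  set f : ℕ → ℕ := fun i => Nat.nth (· ∈ A) (i - 1) with hf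
  have hfin : (Set.ofPred (· ∈ A)).Finite := A.finite_toSet
  have hA : hfin.toFinset = A := by ext; simp
  have hmono := Nat.nth_strictMonoOn hfin
  have himg := Nat.image_nth_Iio_card hfin
  rw [hA] at hmono himg
  have h1 : StrictMonoOn f (Finset.Icc 1 A.card : Finset ℕ) := by
    intro a ha b hb hab
    simp only [Finset.coe_Icc, Set.mem_Icc] at ha hb
    exact hmono (by simp; omega) (by simp; omega) (by omega)
  have h2 : (Finset.Icc 1 A.card).image f = A := by
    ext x
    have := Set.ext_iff.1 himg x
    simp only [Set.mem_image, Set.mem_Iio] at this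
    rw [Finset.mem_image]
    refine Iff.trans ?_ this
    constructor
    · rintro ⟨i, hi, rfl⟩
      rw [Finset.mem_Icc] at hi
      exact ⟨i - 1, by omega, rfl⟩
    · rintro ⟨i, hi, rfl⟩
      exact ⟨i + 1, by rw [Finset.mem_Icc]; omega, rfl⟩
  calc numCollisions A.card ≤ (collisions ((Finset.Icc 1 A.card).image f)).card :=
        card_collisions_image_le h1
    _ = (collisions A).card := by rw [h2]

theorem append_cons_mem_wordsOn {A B : Finset ℕ} {M : ℕ} (hA : ∀ x ∈ A, x < M) (hB : B ⊆ A)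
    {L R : List ℕ} (hL : L ∈ wordsOn B) (hR : R ∈ wordsOn (A \ B)) :
    L ++ M :: R ∈ wordsOn (insert M A) := by
  have hM : M ∉ A := fun h => (hA M h).false
  rw [mem_wordsOn, Finset.insert_val_of_notMem hM, ← Multiset.coe_add, ← Multiset.cons_coe,
    mem_wordsOn.1 hL, mem_wordsOn.1 hR, Multiset.add_cons, Finset.sdiff_val,
    add_tsub_cancel_of_le (Finset.val_le_iff.2 hB)]

/-- Collisions (L, L') on B and (R, R') on the complement glue to (L M R, L' M R'). Cutting at M
recovers the four words, and the letters of L recover B, so gluing is injective. -/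
theorem sum_card_collisions_le {A : Finset ℕ} {M : ℕ} (hA : ∀ x ∈ A, x < M) :
    ∑ B ∈ A.powerset, (collisions B).card * (collisions (A \ B)).card ≤
      (collisions (insert M A)).card := by
  have lt : ∀ {B : Finset ℕ} {l : List ℕ}, B ⊆ A → l ∈ wordsOn B → ∀ x ∈ l, x < M :=
    fun hB hl x hx => hA x (hB ((mem_iff_of_mem_wordsOn hl).1 hx))
  simp_rw [← Finset.card_product]
  rw [← Finset.card_sigma]
  refine Finset.card_le_card_of_injOn
    (fun q => (q.2.1.1 ++ M :: q.2.2.1, q.2.1.2 ++ M :: q.2.2.2)) ?_ ?_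
  · rintro ⟨B, ⟨L, L'⟩, ⟨R, R'⟩⟩ h
    simp only [Finset.coe_sigma, Set.mem_sigma_iff, Finset.mem_coe, Finset.mem_powerset,
      Finset.mem_product, mem_collisions] at h
    obtain ⟨hB, ⟨⟨hL, hL'⟩, eL⟩, ⟨hR, hR'⟩, eR⟩ := h
    have hS : A \ B ⊆ A := Finset.sdiff_subset
    simp only [Finset.mem_coe, mem_collisions]
    refine ⟨⟨append_cons_mem_wordsOn hA hB hL hR, append_cons_mem_wordsOn hA hB hL' hR'⟩, ?_⟩
    rw [stackSort_append_cons (lt hB hL) fun x hx => (lt hS hR x hx).le,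
      stackSort_append_cons (lt hB hL') fun x hx => (lt hS hR' x hx).le, eL, eR]
  · rintro ⟨B, ⟨L, L'⟩, ⟨R, R'⟩⟩ h ⟨C, ⟨K, K'⟩, ⟨Q, Q'⟩⟩ h' e
    simp only [Finset.coe_sigma, Set.mem_sigma_iff, Finset.mem_coe, Finset.mem_powerset,
      Finset.mem_product, mem_collisions] at h h'
    obtain ⟨hB, ⟨⟨hL, hL'⟩, -⟩, -⟩ := h
    obtain ⟨hC, ⟨⟨hK, hK'⟩, -⟩, -⟩ := h'
    have notin : ∀ {D : Finset ℕ} {l : List ℕ}, D ⊆ A → l ∈ wordsOn D → M ∉ l :=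
      fun hD hl hM => (lt hD hl M hM).false
    have split : ∀ {L R K Q : List ℕ}, M ∉ L → M ∉ K → L ++ M :: R = K ++ M :: Q →
        L = K ∧ R = Q := by
      intro L R K Q h1 h2 h
      have hi := congrArg (List.idxOf M) h
      rw [List.idxOf_append, if_neg h1, List.idxOf_append, if_neg h2] at hi
      have := List.append_inj h (by simpa using hi)
      simpa using this
    simp only [Prod.mk.injEq] at e
    obtain ⟨rfl, rfl⟩ := split (notin hB hL) (notin hC hK) e.1
    obtain ⟨rfl, rfl⟩ := split (notin hB hL') (notin hC hK') e.2
    have : B = C := by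
      ext x; rw [← mem_iff_of_mem_wordsOn hL, ← mem_iff_of_mem_wordsOn hK]
    subst this
    rfl

theorem sum_choose_mul_numCollisions_le (n : ℕ) :
    ∑ k ∈ Finset.range (n + 1), n.choose k * (numCollisions k * numCollisions (n - k)) ≤
      numCollisions (n + 1) := by
  have hA : ∀ x ∈ Finset.Icc 1 n, x < n + 1 := fun x hx => by
    rw [Finset.mem_Icc] at hx; omega
  have hI : insert (n + 1) (Finset.Icc 1 n) = Finset.Icc 1 (n + 1) := by
    ext x; simp only [Finset.mem_insert, Finset.mem_Icc]; omega
  have h := sum_card_collisions_le hA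
  rw [hI] at h
  refine le_trans ?_ h
  have e := Finset.sum_powerset_apply_card
    (fun k => numCollisions k * numCollisions (n - k)) (x := Finset.Icc 1 n)
  simp only [Nat.card_Icc, add_tsub_cancel_right, smul_eq_mul] at e
  rw [← e]
  refine Finset.sum_le_sum fun B hB => ?_
  have hc : (Finset.Icc 1 n \ B).card = n - B.card := by
    rw [Finset.card_sdiff_of_subset (Finset.mem_powerset.1 hB)]; simp
  exact Nat.mul_le_mul (numCollisions_le B) (hc ▸ numCollisions_le _)

theorem four_le_numCollisions_two : 4 ≤ numCollisions 2 := by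
  have h12 : stackSort [1, 2] = [1, 2] := by
    simp [stackSort, left, right, largest]
  have h21 : stackSort [2, 1] = [1, 2] := by
    simp [stackSort, left, right, largest]
  have hw : ∀ l ∈ ({[1, 2], [2, 1]} : Finset (List ℕ)),
      l ∈ wordsOn (Finset.Icc 1 2) ∧ stackSort l = [1, 2] := by
    intro l hl
    simp only [Finset.mem_insert, Finset.mem_singleton] at hl
    rcases hl with rfl | rfl
    · exact ⟨mem_wordsOn.2 (by decide), h12⟩
    · exact ⟨mem_wordsOn.2 (by decide), h21⟩
  have : ({[1, 2], [2, 1]} ×ˢ {[1, 2], [2, 1]} : Finset (List ℕ × List ℕ)) ⊆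
      collisions (Finset.Icc 1 2) := by
    intro p hp
    rw [Finset.mem_product] at hp
    obtain ⟨h1, e1⟩ := hw _ hp.1
    obtain ⟨h2, e2⟩ := hw _ hp.2
    exact mem_collisions.2 ⟨⟨h1, h2⟩, e1.trans e2.symm⟩
  exact (by decide : 4 = ({[1, 2], [2, 1]} ×ˢ {[1, 2], [2, 1]} :
    Finset (List ℕ × List ℕ)).card).trans_le (Finset.card_le_card this)

/-! ### Fekete's lemma with a logarithmic error -/

/-- A sequence that is superadditive on summands of ratio at most two dominates, up to a bounded
error, the linear function through any of its values. -/
theorem exists_mul_sub_le_of_balanced_superadditive {w : ℕ → ℝ}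
    (hw : ∀ a b, 0 < a → 0 < b → a ≤ 2 * b → b ≤ 2 * a → w a + w b ≤ w (a + b))
    {m : ℕ} (hm : 0 < m) :
    ∃ K : ℝ, 0 ≤ K ∧ ∀ k r, 0 < k → r < m → k * w m - K ≤ w (k * m + r) := by
  -- Multiples of `m` incur no error: halving k always gives a balanced split.
  have h0 : ∀ k : ℕ, 0 < k → k * w m ≤ w (k * m) := by
    intro k
    induction k using Nat.strong_induction_on with
    | _ k ih =>
      intro hk
      rcases Nat.lt_or_ge k 2 with h | h
      · obtain rfl : k = 1 := by omega
        simp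
      · obtain ⟨a, b, rfl, ha, hb, h1, h2⟩ : ∃ a b, k = a + b ∧ 0 < a ∧ 0 < b ∧ a ≤ 2 * b ∧
            b ≤ 2 * a := ⟨k / 2, k - k / 2, by omega⟩
        have := hw (a * m) (b * m) (by positivity) (by positivity) (by nlinarith) (by nlinarith)
        have i1 := ih a (by omega) ha
        have i2 := ih b (by omega) hb
        rw [add_mul]
        push_cast
        linarith
  obtain ⟨K, hK⟩ : ∃ K : ℝ, ∀ r ∈ Finset.range m, w m - w (m + r) ≤ K :=
    ((Finset.range m).image fun r => w m - w (m + r)).bddAbove.imp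
      fun K hK r hr => hK (Finset.mem_coe.2 (Finset.mem_image_of_mem _ hr))
  have hK0 : 0 ≤ K := by simpa using hK 0 (by simpa using hm)
  refine ⟨K, hK0, fun k => ?_⟩
  induction k using Nat.strong_induction_on with
  | _ k ih =>
    intro r hk hr
    rcases Nat.lt_or_ge k 2 with h | h
    · obtain rfl : k = 1 := by omega
      have := hK r (by simpa using hr)
      simp only [Nat.cast_one, one_mul]
      linarith
    -- The remainder joins the smaller half, which keeps the split balanced. The other half is an
    -- exact multiple of `m`, so `K` is paid only once.
    · obtain ⟨a, b, rfl, ha, hb, h1, h2⟩ : ∃ a b, k = a + b ∧ 0 < a ∧ 0 < b ∧ a ≤ b ∧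
          b ≤ a + 1 := ⟨k / 2, k - k / 2, by omega⟩
      have := hw (a * m + r) (b * m) (by positivity) (by positivity) (by nlinarith) (by nlinarith)
      have i1 := ih a (by omega) r ha hr
      have i2 := h0 b hb
      rw [show (a + b) * m + r = a * m + r + b * m by ring]
      push_cast
      linarith

theorem exists_tendsto_div_of_balanced_superadditive {w : ℕ → ℝ}
    (hw : ∀ a b, 0 < a → 0 < b → a ≤ 2 * b → b ≤ 2 * a → w a + w b ≤ w (a + b))
    {C : ℝ} (hC : ∀ n, 0 < n → w n ≤ C * n) :
    ∃ l : ℝ, Tendsto (fun n : ℕ => w n / n) atTop (𝓝 l) := by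
  set T : Set ℝ := (fun n : ℕ => w n / n) '' Set.Ioi 0
  have hT : BddAbove T := by
    refine ⟨C, ?_⟩
    rintro _ ⟨n, hn, rfl⟩
    have : (0 : ℝ) < n := by exact_mod_cast hn
    exact (div_le_iff₀ this).2 (hC n hn)
  have hne : T.Nonempty := ⟨_, 1, by simp, rfl⟩
  refine ⟨sSup T, Metric.tendsto_atTop.2 fun ε hε => ?_⟩
  obtain ⟨_, ⟨m, hm, rfl⟩, hlt⟩ := exists_lt_of_lt_csSup hne (sub_lt_self (sSup T) (half_pos hε))
  have hm0 : 0 < m := hm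
  have hmR : (0 : ℝ) < m := by exact_mod_cast hm0
  obtain ⟨K, hK0, hK⟩ := exists_mul_sub_le_of_balanced_superadditive hw hm0
  obtain ⟨N, hN⟩ := exists_nat_gt ((K + |w m|) / (ε / 2))
  refine ⟨max N m, fun n hn => ?_⟩
  have hmn : m ≤ n := (le_max_right _ _).trans hn
  have hn0 : 0 < n := hm0.trans_le hmn
  have hnR : (0 : ℝ) < n := by exact_mod_cast hn0
  have hup : w n / n ≤ sSup T := le_csSup hT ⟨n, hn0, rfl⟩
  have hdm : n / m * m + n % m = n := by rw [mul_comm]; exact Nat.div_add_mod n m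
  have hlow := hK (n / m) (n % m) (Nat.div_pos hmn hm0) (Nat.mod_lt _ hm0)
  rw [hdm] at hlow
  -- Rounding `n` down to a multiple of `m` costs a bounded amount.
  have hq : |((n / m : ℕ) : ℝ) * w m - n * (w m / m)| ≤ |w m| := by
    have : ((n / m : ℕ) : ℝ) * w m - n * (w m / m) = -(((n % m : ℕ) : ℝ) / m) * w m := by
      have : (n : ℝ) = ((n / m : ℕ) : ℝ) * m + ((n % m : ℕ) : ℝ) := by exact_mod_cast hdm.symm
      rw [this]; field_simp; ring
    rw [this, abs_mul, abs_neg, abs_of_nonneg (by positivity)]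
    refine mul_le_of_le_one_left (abs_nonneg _) ?_
    rw [div_le_one hmR]
    exact_mod_cast (Nat.mod_lt _ hm0).le
  have hq' := (abs_le.1 hq).1
  have hbig : K + |w m| < n * (ε / 2) := by
    rw [div_lt_iff₀ (half_pos hε)] at hN
    refine hN.trans_le (mul_le_mul_of_nonneg_right ?_ (half_pos hε).le)
    exact_mod_cast (le_max_left _ _).trans hn
  have hfin : w m / m - ε / 2 < w n / n := by
    rw [lt_div_iff₀ hnR]
    nlinarith
  rw [Real.dist_eq, abs_lt]
  constructor <;> linarith

/-- A form of the de Bruijn–Erdős theorem: Fekete's lemma with a logarithmic error. -/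
theorem exists_tendsto_div_of_superadditive_log {u : ℕ → ℝ}
    (hu : ∀ a b, 0 < a → 0 < b → u a + u b - Real.log (a + b) ≤ u (a + b))
    {C : ℝ} (hC : ∀ n, 0 < n → u n ≤ C * n) :
    ∃ l : ℝ, Tendsto (fun n : ℕ => u n / n) atTop (𝓝 l) := by
  set c : ℝ := Real.log 5 with hc
  have hc0 : 0 ≤ c := Real.log_nonneg (by norm_num)
  obtain ⟨l, hl⟩ := exists_tendsto_div_of_balanced_superadditive
    (w := fun n => u n - Real.log n - c) (C := C) (by
      -- Subtracting log n + c absorbs the error on balanced pairs, where (a + b)² ≤ 5ab; this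
      -- follows from (2b - a)(2a - b) ≥ 0 and is the origin of the 5.
      intro a b ha hb hab hba
      have haR : (0 : ℝ) < a := by exact_mod_cast ha
      have hbR : (0 : ℝ) < b := by exact_mod_cast hb
      have hab' : (a : ℝ) ≤ 2 * b := by exact_mod_cast hab
      have hba' : (b : ℝ) ≤ 2 * a := by exact_mod_cast hba
      have h := hu a b ha hb
      have hlog : 2 * Real.log ((a : ℝ) + b) ≤ c + Real.log a + Real.log b := by
        rw [hc, ← Real.log_mul (by norm_num) haR.ne', ← Real.log_mul (by positivity) hbR.ne',
          two_mul, ← Real.log_mul (by positivity) (by positivity)]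
        refine Real.log_le_log (by positivity) ?_
        nlinarith [mul_nonneg (sub_nonneg.2 hab') (sub_nonneg.2 hba'), mul_pos haR hbR]
      push_cast
      linarith) (by
      intro n hn
      have := Real.log_natCast_nonneg n
      have := hC n hn
      linarith)
  refine ⟨l, ?_⟩
  have h1 : Tendsto (fun n : ℕ => Real.log n / (n : ℝ)) atTop (𝓝 0) :=
    (Real.isLittleO_log_id_atTop.tendsto_div_nhds_zero).comp tendsto_natCast_atTop_atTop
  have h2 : Tendsto (fun n : ℕ => c / (n : ℝ)) atTop (𝓝 0) := tendsto_const_div_atTop_nhds_zero_nat c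
  have := (hl.add h1).add h2
  rw [add_zero, add_zero] at this
  refine this.congr fun n => ?_
  ring

theorem exists_tendsto_log_div_of_mul_le {d : ℕ → ℝ} (hpos : ∀ n, 0 < d n)
    (hmul : ∀ a b : ℕ, d a * d b ≤ (a + b + 1) * d (a + b + 1))
    {B : ℝ} (hB : 1 ≤ B) (hle : ∀ n, d n ≤ B ^ n) :
    ∃ l : ℝ, Tendsto (fun n : ℕ => Real.log (d n) / n) atTop (𝓝 l) := by
  obtain ⟨l, hl⟩ := exists_tendsto_div_of_superadditive_log
    -- The shift turns the index a + b + 1 of the hypothesis into a plain sum of indices.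
    (u := fun n => Real.log (d (n - 1))) (C := Real.log B) (by
      intro a b ha hb
      obtain ⟨a, rfl⟩ : ∃ a', a = a' + 1 := ⟨a - 1, by omega⟩
      obtain ⟨b, rfl⟩ : ∃ b', b = b' + 1 := ⟨b - 1, by omega⟩
      have h := hmul a b
      have h' := Real.log_le_log (mul_pos (hpos a) (hpos b)) h
      rw [Real.log_mul (hpos a).ne' (hpos b).ne',
        Real.log_mul (by positivity) (hpos _).ne'] at h'
      have h2 : Real.log ((a : ℝ) + b + 1) ≤ Real.log (((a + 1 : ℕ) : ℝ) + ((b + 1 : ℕ) : ℝ)) :=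
        Real.log_le_log (by positivity) (by push_cast; linarith)
      rw [Nat.add_sub_cancel, Nat.add_sub_cancel, show a + 1 + (b + 1) - 1 = a + b + 1 by omega]
      linarith) (by
      intro n hn
      have h := Real.log_le_log (hpos _) (hle (n - 1))
      rw [Real.log_pow] at h
      refine h.trans ?_
      rw [mul_comm]
      refine mul_le_mul_of_nonneg_left ?_ (Real.log_nonneg hB)
      exact_mod_cast Nat.sub_le n 1)
  refine ⟨l, ?_⟩
  have h1 : Tendsto (fun n : ℕ => Real.log (d n) / ((n + 1 : ℕ) : ℝ))
      atTop (𝓝 l) :=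
    hl.comp (tendsto_add_atTop_nat 1)
  have h2 : Tendsto (fun n : ℕ => 1 + 1 / (n : ℝ)) atTop (𝓝 (1 + 0)) :=
    tendsto_const_nhds.add tendsto_one_div_atTop_nhds_zero_nat
  have h3 := h1.mul h2
  rw [add_zero, mul_one] at h3
  refine h3.congr' ?_
  filter_upwards [eventually_gt_atTop 0] with n hn
  have : (n : ℝ) ≠ 0 := by exact_mod_cast hn.ne'
  push_cast
  field_simp

/-! ### Lower bound from the recurrence -/

/-- Growth bound for sequences with `d 0, d 1 ≥ 1`, `d 2 ≥ 2` and
`(n + 1) * d (n + 1) ≥ ∑ d k * d (n - k)`. -/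
theorem pow_le_of_sum_le {d : ℕ → ℝ} (h0 : 1 ≤ d 0) (h1 : 1 ≤ d 1) (h2 : 2 ≤ d 2)
    (hd : ∀ n : ℕ, ∑ k ∈ Finset.range (n + 1), d k * d (n - k) ≤ (n + 1) * d (n + 1))
    {n : ℕ} (hn : 2 ≤ n) : (1.12462 : ℝ) ^ (n + 1) ≤ d n := by
  set q : ℝ := 1.12462 with hq
  have hqpos : 0 < q := by norm_num [hq]
  -- With exponent n + 1 every product in the sum carries the same power q^(n+2), so `h` satisfies
  -- the same recurrence as `d`.
  set h : ℕ → ℝ := fun n => d n / q ^ (n + 1) with hh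
  have hsum : ∀ n : ℕ, ∑ k ∈ Finset.range (n + 1), h k * h (n - k) ≤ (n + 1) * h (n + 1) := by
    intro n
    have e : ∀ k ∈ Finset.range (n + 1), h k * h (n - k) = d k * d (n - k) / q ^ (n + 2) := by
      intro k hk
      have : k ≤ n := Nat.lt_succ_iff.1 (Finset.mem_range.1 hk)
      simp only [hh]
      rw [div_mul_div_comm, ← pow_add]
      congr 2
      omega
    rw [Finset.sum_congr rfl e, ← Finset.sum_div, hh, ← mul_div_assoc]
    exact div_le_div_of_nonneg_right (hd n) (by positivity)
  have b0 : 0.889 ≤ h 0 := by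
    simp only [hh]; rw [le_div_iff₀ (by positivity)]; refine le_trans ?_ h0; norm_num [hq]
  have b1 : 0.79 ≤ h 1 := by
    simp only [hh]; rw [le_div_iff₀ (by positivity)]; refine le_trans ?_ h1; norm_num [hq]
  have b2 : 1.4 ≤ h 2 := by
    simp only [hh]; rw [le_div_iff₀ (by positivity)]; refine le_trans ?_ h2; norm_num [hq]
  suffices H : ∀ n, 2 ≤ n → 1 ≤ h n by
    have := H n hn
    simp only [hh] at this
    rwa [le_div_iff₀ (by positivity), one_mul] at this
  have b3 : 1.03 ≤ h 3 := by
    have := hsum 2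
    norm_num [Finset.sum_range_succ] at this
    nlinarith
  have b4 : 1 ≤ h 4 := by
    have := hsum 3
    norm_num [Finset.sum_range_succ] at this
    nlinarith
  have b5 : 1 ≤ h 5 := by
    have := hsum 4
    norm_num [Finset.sum_range_succ] at this
    nlinarith
  intro n
  induction n using Nat.strong_induction_on with
  | _ n ih =>
    intro hn
    rcases Nat.lt_or_ge n 6 with hlt | hge
    · interval_cases n
      · linarith
      · linarith
      · exact b4
      · exact b5
    -- Of the m + 6 terms, the m middle ones are at least 1. The three at each end total at least
    -- 2(0.889 + 0.79 + 1.4) > 6: the surplus of `h 2` outweighs the deficits of `h 0` and `h 1`.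
    obtain ⟨m, rfl⟩ : ∃ m, n = m + 6 := ⟨n - 6, by omega⟩
    have hs := hsum (m + 5)
    have hmid : (m : ℝ) ≤ ∑ k ∈ Finset.range m, h (k + 3) * h (m + 2 - k) := by
      have : ∑ k ∈ Finset.range m, (1 : ℝ) ≤ ∑ k ∈ Finset.range m, h (k + 3) * h (m + 2 - k) := by
        refine Finset.sum_le_sum fun k hk => ?_
        rw [Finset.mem_range] at hk
        exact one_le_mul_of_one_le_of_one_le (ih _ (by omega) (by omega))
          (ih _ (by omega) (by omega))
      simpa using this
    have e : ∑ k ∈ Finset.range (m + 5 + 1), h k * h (m + 5 - k) =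
        (∑ k ∈ Finset.range m, h (k + 3) * h (m + 2 - k)) + h 0 * h (m + 5) + h 1 * h (m + 4) +
          h 2 * h (m + 3) + h (m + 3) * h 2 + h (m + 4) * h 1 + h (m + 5) * h 0 := by
      rw [Finset.sum_range_succ, Finset.sum_range_succ, Finset.sum_range_succ,
        Finset.sum_range_succ', Finset.sum_range_succ', Finset.sum_range_succ']
      have e1 : ∀ k, m + 5 - (k + 1 + 1 + 1) = m + 2 - k := fun k => by omega
      simp only [e1, show m + 2 - m = 2 by omega, show m + 2 - (m + 1) = 1 by omega,
        show m + 2 - (m + 2) = 0 by omega, show m + 5 - (0 + 1 + 1) = m + 3 by omega,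
        show m + 5 - (0 + 1) = m + 4 by omega, show m + 5 - 0 = m + 5 by omega,
        zero_add, add_assoc, Nat.reduceAdd]
      ring
    rw [e] at hs
    have i3 := ih (m + 3) (by omega) (by omega)
    have i4 := ih (m + 4) (by omega) (by omega)
    have i5 := ih (m + 5) (by omega) (by omega)
    have p0 : 0.889 ≤ h 0 * h (m + 5) := by nlinarith
    have p1 : 0.79 ≤ h 1 * h (m + 4) := by nlinarith
    have p2 : 1.4 ≤ h 2 * h (m + 3) := by nlinarith
    have hs' : (m : ℝ) + 6 ≤ (m + 6) * h (m + 6) := by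
      push_cast at hs
      rw [show m + 5 + 1 = m + 6 by omega] at hs
      linarith
    have hm6 : (0 : ℝ) < m + 6 := by positivity
    exact le_of_mul_le_mul_left (by linarith) hm6

/-! ### Fibres and decreasing binary trees -/

/-- The shape of the decreasing binary tree of a word. -/
def treeShape (l : List ℕ) : BinaryTree Unit :=
  if l = [] then .nil
  else .node () (treeShape (left l)) (treeShape (right l))
termination_by l.length
decreasing_by
  · exact length_left_lt ‹_›
  · exact length_right_lt ‹_›

theorem numNodes_treeShape (l : List ℕ) : (treeShape l).numNodes = l.length := by
  induction hn : l.length using Nat.strong_induction_on generalizing l with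
  | _ n ih =>
    subst hn
    rw [treeShape]
    split_ifs with h
    · simp [h, BinaryTree.numNodes]
    · have e := congrArg List.length (left_append_largest_right h)
      rw [List.length_append, List.length_cons] at e
      rw [BinaryTree.numNodes, ih _ (length_left_lt h) _ rfl, ih _ (length_right_lt h) _ rfl]
      omega

theorem length_stackSort (l : List ℕ) : (stackSort l).length = l.length :=
  (stackSort_perm l).length_eq

/-- The image s(L) s(R) m ends in the largest letter, and the node count of the left subtree shows
where s(L) stops; recursion recovers L and R. -/
theorem eq_of_stackSort_eq_of_treeShape_eq {l l' : List ℕ} (hs : stackSort l = stackSort l')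
    (ht : treeShape l = treeShape l') : l = l' := by
  induction hn : l.length using Nat.strong_induction_on generalizing l l' with
  | _ n ih =>
    subst hn
    have hlen : l.length = l'.length := by rw [← length_stackSort, hs, length_stackSort]
    rcases eq_or_ne l [] with rfl | h
    · exact (List.length_eq_zero_iff.1 hlen.symm).symm
    have h' : l' ≠ [] := by
      rintro rfl
      exact h (List.length_eq_zero_iff.1 hlen)
    rw [treeShape.eq_1 l, if_neg h, treeShape.eq_1 l', if_neg h'] at ht
    rw [stackSort.eq_1 l, if_neg h, stackSort.eq_1 l', if_neg h'] at hs
    injection ht with _ tL tR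
    obtain ⟨hs, hM⟩ := List.append_inj' hs rfl
    obtain ⟨sL, sR⟩ := List.append_inj hs (by
      rw [length_stackSort, length_stackSort, ← numNodes_treeShape, tL, numNodes_treeShape])
    rw [← left_append_largest_right h, ← left_append_largest_right h',
      ih _ (length_left_lt h) sL tL rfl, ih _ (length_right_lt h) sR tR rfl,
      List.singleton_inj.1 hM]

theorem catalan_le_four_pow (n : ℕ) : catalan n ≤ 4 ^ n := by
  rw [catalan_eq_centralBinom_div]
  refine (Nat.div_le_self _ _).trans ?_
  rw [Nat.centralBinom_eq_two_mul_choose]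
  refine (Nat.choose_le_two_pow _ _).trans ?_
  rw [pow_mul]; norm_num

theorem ncard_fiber_le (n : ℕ) (y : S n) : (stackSortMap n ⁻¹' {y}).ncard ≤ 4 ^ n := by
  refine le_trans ?_ ((BinaryTree.treesOfNumNodesEq_card_eq_catalan n).trans_le
    (catalan_le_four_pow n))
  rw [← Set.ncard_coe_finset]
  refine Set.ncard_le_ncard_of_injOn (fun w => treeShape w.1) ?_ ?_ (Finset.finite_toSet _)
  · intro w _
    rw [Finset.mem_coe, BinaryTree.mem_treesOfNumNodesEq, numNodes_treeShape, w.2.length_eq]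
    simp
  · intro v hv w hw h
    have e : stackSortMap n v = stackSortMap n w := hv.trans hw.symm
    exact Subtype.ext (eq_of_stackSort_eq_of_treeShape_eq (congrArg Subtype.val e) h)

/-! ### From collisions to degrees -/

theorem card_S (n : ℕ) : Fintype.card (S n) = n.factorial := by
  have h := List.nodup_permutations _ (List.nodup_range' (s := 1) (n := n))
  rw [Fintype.card_of_subtype (List.range' 1 n).permutations.toFinset (by simp)]
  refine (List.toFinset_card_of_nodup h).trans ?_
  rw [List.length_permutations, List.length_range']

theorem mem_wordsOn_Icc {n : ℕ} {l : List ℕ} :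
    l ∈ wordsOn (Finset.Icc 1 n) ↔ l.Perm (List.range' 1 n) := by
  rw [mem_wordsOn, ← Multiset.coe_eq_coe]
  rfl

theorem sum_ncard_fiber (n : ℕ) :
    ∑ x : S n, (stackSortMap n ⁻¹' {stackSortMap n x}).ncard = numCollisions n := by
  classical
  have h : ∀ x : S n, (stackSortMap n ⁻¹' {stackSortMap n x}).ncard =
      (Finset.univ.filter fun y => stackSortMap n y = stackSortMap n x).card := by
    intro x
    rw [← Set.ncard_coe_finset]
    congr 1
    ext y
    simp
  simp_rw [h]
  rw [← Finset.card_sigma, numCollisions]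
  refine Finset.card_bij (fun q _ => (q.1.1, q.2.1)) ?_ ?_ ?_
  · rintro ⟨x, y⟩ hq
    simp only [Finset.mem_sigma, Finset.mem_filter, Finset.mem_univ, true_and] at hq
    exact mem_collisions.2 ⟨⟨mem_wordsOn_Icc.2 x.2, mem_wordsOn_Icc.2 y.2⟩,
      (congrArg Subtype.val hq).symm⟩
  · rintro ⟨x, y⟩ _ ⟨x', y'⟩ _ e
    simp only [Prod.mk.injEq] at e
    obtain rfl := Subtype.ext e.1
    obtain rfl := Subtype.ext e.2
    rfl
  · rintro ⟨l, l'⟩ hp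
    obtain ⟨⟨h1, h2⟩, h3⟩ := mem_collisions.1 hp
    refine ⟨⟨⟨l, mem_wordsOn_Icc.1 h1⟩, ⟨l', mem_wordsOn_Icc.1 h2⟩⟩, ?_, rfl⟩
    simp only [Finset.mem_sigma, Finset.mem_filter, Finset.mem_univ, true_and]
    exact Subtype.ext h3.symm

theorem degree_stackSortMap (n : ℕ) :
    degree (stackSortMap n) = numCollisions n / n.factorial := by
  rw [degree, card_S, ← Nat.cast_sum, sum_ncard_fiber, one_div_mul_eq_div]

theorem one_le_degree_stackSortMap (n : ℕ) : 1 ≤ degree (stackSortMap n) := by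
  rw [degree_stackSortMap, one_le_div (by positivity), ← card_S, ← sum_ncard_fiber]
  norm_cast
  rw [← Finset.card_univ, Finset.card_eq_sum_ones]
  refine Finset.sum_le_sum fun x _ => ?_
  exact Nat.one_le_iff_ne_zero.2 (Set.ncard_ne_zero_of_mem (a := x) rfl (Set.toFinite _))

theorem degree_stackSortMap_le (n : ℕ) : degree (stackSortMap n) ≤ 4 ^ n := by
  rw [degree_stackSortMap, div_le_iff₀ (by positivity), ← card_S, ← sum_ncard_fiber]
  norm_cast
  refine (Finset.sum_le_card_nsmul _ _ _ fun x _ => ncard_fiber_le n _).trans ?_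
  rw [Finset.card_univ, smul_eq_mul, mul_comm]

theorem two_le_degree_stackSortMap_two : 2 ≤ degree (stackSortMap 2) := by
  rw [degree_stackSortMap, le_div_iff₀ (by positivity)]
  exact_mod_cast four_le_numCollisions_two

/-- Dividing the recurrence for collisions by n! cancels the binomial coefficients; the factor n + 1
comes from (n+1)!. -/
theorem sum_degree_mul_degree_le (n : ℕ) :
    ∑ k ∈ Finset.range (n + 1), degree (stackSortMap k) * degree (stackSortMap (n - k)) ≤
      (n + 1) * degree (stackSortMap (n + 1)) := by
  have h : (∑ k ∈ Finset.range (n + 1),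
      (n.choose k : ℝ) * (numCollisions k * numCollisions (n - k))) ≤ numCollisions (n + 1) := by
    exact_mod_cast sum_choose_mul_numCollisions_le n
  have hr : ((n : ℝ) + 1) * degree (stackSortMap (n + 1)) =
      numCollisions (n + 1) / n.factorial := by
    rw [degree_stackSortMap, Nat.factorial_succ]
    push_cast
    field_simp
  rw [hr, le_div_iff₀ (by positivity), Finset.sum_mul]
  refine le_trans (le_of_eq (Finset.sum_congr rfl fun k hk => ?_)) h
  rw [degree_stackSortMap, degree_stackSortMap,
    Nat.cast_choose ℝ (Nat.lt_succ_iff.1 (Finset.mem_range.1 hk))]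
  field_simp

theorem degree_mul_degree_le (a b : ℕ) :
    degree (stackSortMap a) * degree (stackSortMap b) ≤
      (a + b + 1) * degree (stackSortMap (a + b + 1)) := by
  have h0 : ∀ n, 0 ≤ degree (stackSortMap n) := fun n =>
    zero_le_one.trans (one_le_degree_stackSortMap n)
  have h := sum_degree_mul_degree_le (a + b)
  have := Finset.single_le_sum (f := fun k => degree (stackSortMap k) *
    degree (stackSortMap (a + b - k))) (fun k _ => mul_nonneg (h0 _) (h0 _))
    (Finset.mem_range.2 (show a < a + b + 1 by omega))
  rw [Nat.add_sub_cancel_left] at this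
  push_cast at h
  exact this.trans h

theorem exists_tendsto_log_degree_div :
    ∃ l : ℝ, Tendsto (fun n : ℕ => Real.log (degree (stackSortMap n)) / n) atTop (𝓝 l) :=
  exists_tendsto_log_div_of_mul_le
    (fun n => zero_lt_one.trans_le (one_le_degree_stackSortMap n)) degree_mul_degree_le
    (by norm_num) degree_stackSortMap_le

end StackSorting

theorem theorem2p5 :
    ∃ c : ℝ,
      Tendsto (fun n : ℕ => StackSorting.degree (StackSorting.stackSortMap n) ^ (1 / (n : ℝ)))
        atTop (𝓝 c) ∧
      1.12462 ≤ c ∧ c ≤ 4 := by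
  obtain ⟨l, hl⟩ := StackSorting.exists_tendsto_log_degree_div
  have hpos : ∀ n, 0 < StackSorting.degree (StackSorting.stackSortMap n) := fun n =>
    zero_lt_one.trans_le (StackSorting.one_le_degree_stackSortMap n)
  have hlim : Tendsto (fun n : ℕ =>
      StackSorting.degree (StackSorting.stackSortMap n) ^ (1 / (n : ℝ)))
      atTop (𝓝 (Real.exp l)) := by
    refine ((Real.continuous_exp.tendsto l).comp hl).congr fun n => ?_
    rw [Real.rpow_def_of_pos (hpos n), Function.comp_apply, mul_one_div]
  have hroot : ∀ (x : ℝ) (n : ℕ), 0 ≤ x → n ≠ 0 → (x ^ n) ^ (1 / (n : ℝ)) = x := by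
    intro x n hx hn
    rw [one_div]
    exact Real.pow_rpow_inv_natCast hx hn
  refine ⟨Real.exp l, hlim, ge_of_tendsto hlim ?_, le_of_tendsto hlim ?_⟩
  · filter_upwards [eventually_ge_atTop 2] with n hn
    have h := StackSorting.pow_le_of_sum_le
      (d := fun n => StackSorting.degree (StackSorting.stackSortMap n))
      (StackSorting.one_le_degree_stackSortMap 0) (StackSorting.one_le_degree_stackSortMap 1)
      StackSorting.two_le_degree_stackSortMap_two StackSorting.sum_degree_mul_degree_le hn
    rw [← hroot 1.12462 n (by norm_num) (by omega)]
    refine Real.rpow_le_rpow (by positivity) (le_trans ?_ h) (by positivity)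
    exact pow_le_pow_right₀ (by norm_num) (Nat.le_succ n)
  · filter_upwards [eventually_ge_atTop 1] with n hn
    rw [← hroot 4 n (by norm_num) (by omega)]
    exact Real.rpow_le_rpow (hpos n).le (StackSorting.degree_stackSortMap_le n) (by positivity)
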